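/- For $h \ge 0$, let $T_h$ be the complete binary tree of height $h$, drawn in the plane with the root at the top and branching down to the left and right, so that there are $2^l$ vertices at distance $l$ from the root for each $0 \le l \le h$. The X-tree of height $h$ is obtained from $T_h$ by adding, for each $l$, the horizontal path which joins the $2^l$ vertices at distance $l$ from the root in their order from left to right. The extended X-tree of height $h$ is obtained from the X-tree by adding, for each of these paths, an edge joining its two endpoints, unless these coincide or are already adjacent. A finite graph is subhamiltonian if it is a subgraph of a finite planar graph that has a cycle through all of its vertices. A $k$-page book embedding of a graph is an embedding of it in the union of $k$ closed half-planes (the pages) with common boundary line $L$, such that all vertices lie on $L$ and each edge lies in a single page and meets $L$ exactly in its two endpoints. Statement: for every $h \ge 0$, the extended X-tree of height $h$ and the X-tree of height $h$ are subhamiltonian, and both have a two-page book embedding. -/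

import Mathlib

/-! ### Drawings of graphs in topological spaces -/

/-- An embedding of the graph `G` in the topological space `X`: vertices are sent to distinct
points, every edge is sent to a simple arc joining the images of its two endpoints, the interior
of an arc contains no vertex, and two different arcs meet at most in vertices. -/
structure GraphEmbedding {V : Type*} (G : SimpleGraph V) (X : Type*) [TopologicalSpace X] where
  /-- the point representing a vertex -/
  pt : V → X
  /-- the arc representing an edge -/
  arc : G.edgeSet → unitInterval → X
  pt_injective : Function.Injective pt
  arc_continuous : ∀ e, Continuous (arc e)
  arc_injective : ∀ e, Function.Injective (arc e)
  arc_ends : ∀ e, s(arc e 0, arc e 1) = (e : Sym2 V).map pt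
  arc_interior : ∀ e t, arc e t ∈ Set.range pt → t = 0 ∨ t = 1
  arc_disjoint : ∀ e f, e ≠ f → ∀ s t, arc e s = arc f t → arc e s ∈ Set.range pt

/-- A graph is planar if it can be embedded in the Euclidean plane. -/
def IsPlanarGraph {V : Type*} (G : SimpleGraph V) : Prop :=
  Nonempty (GraphEmbedding G (EuclideanSpace ℝ (Fin 2)))

/-- A finite graph is subhamiltonian if it is (isomorphic to) a subgraph, not necessarily
spanning, of a finite planar Hamiltonian graph. -/
def IsSubhamiltonian {V : Type*} (G : SimpleGraph V) : Prop :=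
  ∃ (n : ℕ) (H : SimpleGraph (Fin n)), IsPlanarGraph H ∧ H.IsHamiltonian ∧ G.IsContained H

/-! ### Book embeddings -/

/-- The book with `k` pages: `k` closed half-planes glued along their common boundary line.
The point `(x, y)` with `y i = r ≥ 0` and all other `y j = 0` is the point `x + r * I` of the
`i`-th half-plane. -/
def Book (k : ℕ) : Type :=
  {p : ℝ × (Fin k → ℝ) // (∀ i, 0 ≤ p.2 i) ∧ ∀ i j, i ≠ j → p.2 i = 0 ∨ p.2 j = 0}

instance (k : ℕ) : TopologicalSpace (Book k) :=
  inferInstanceAs (TopologicalSpace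
    {p : ℝ × (Fin k → ℝ) // (∀ i, 0 ≤ p.2 i) ∧ ∀ i j, i ≠ j → p.2 i = 0 ∨ p.2 j = 0})

/-- The spine of the book. -/
def Book.spine (k : ℕ) : Set (Book k) := {p | ∀ i, p.1.2 i = 0}

/-- The `i`-th page of the book, a closed half-plane containing the spine. -/
def Book.page {k : ℕ} (i : Fin k) : Set (Book k) := {p | ∀ j, j ≠ i → p.1.2 j = 0}

/-- `G` has a `k`-page book embedding: an embedding in the book with `k` pages such that all
vertices lie on the spine and every edge lies in a single page and meets the spine exactly in
its endpoints. -/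
def HasBookEmbedding {V : Type*} (G : SimpleGraph V) (k : ℕ) : Prop :=
  ∃ φ : GraphEmbedding G (Book k),
    (∀ v, φ.pt v ∈ Book.spine k) ∧
    ∀ e, (∃ i : Fin k, ∀ t, φ.arc e t ∈ Book.page i) ∧
      ∀ t, φ.arc e t ∈ Book.spine k ↔ t = 0 ∨ t = 1

/-! ### X-trees -/

/-- The vertices of the complete binary tree of height `h`: the pair `⟨l, k⟩` is the `k`-th
vertex, counted from the left and starting with `0`, among the `2 ^ l` vertices at distance `l`
from the root. -/
abbrev XTreeVertex (h : ℕ) : Type := Σ l : Fin (h + 1), Fin (2 ^ (l : ℕ))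

/-- The complete binary tree of height `h`: the left and right child of `⟨l, k⟩` are
`⟨l + 1, 2 * k⟩` and `⟨l + 1, 2 * k + 1⟩`. -/
def completeBinaryTree (h : ℕ) : SimpleGraph (XTreeVertex h) :=
  SimpleGraph.fromRel fun a b =>
    (b.1 : ℕ) = a.1 + 1 ∧ ((b.2 : ℕ) = 2 * a.2 ∨ (b.2 : ℕ) = 2 * a.2 + 1)

/-- The horizontal paths: on each level, every vertex is joined to the next one on its right. -/
def levelPaths (h : ℕ) : SimpleGraph (XTreeVertex h) :=
  SimpleGraph.fromRel fun a b => (b.1 : ℕ) = a.1 ∧ (b.2 : ℕ) = a.2 + 1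

/-- The closing edges: on each level, the leftmost vertex is joined to the rightmost one, if
they are different (on level `1` this edge is already in the horizontal path). -/
def levelClosingEdges (h : ℕ) : SimpleGraph (XTreeVertex h) :=
  SimpleGraph.fromRel fun a b =>
    (b.1 : ℕ) = a.1 ∧ (a.2 : ℕ) = 0 ∧ (b.2 : ℕ) + 1 = 2 ^ (b.1 : ℕ)

/-- The X-tree of height `h`. -/
def xTree (h : ℕ) : SimpleGraph (XTreeVertex h) :=
  completeBinaryTree h ⊔ levelPaths h

/-- The extended X-tree of height `h`. -/
def extendedXTree (h : ℕ) : SimpleGraph (XTreeVertex h) :=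
  xTree h ⊔ levelClosingEdges h

/-! Everything reduces to a combinatorial two-page layout. Put the levels on the spine in
consecutive blocks, alternately from left to right and from right to left, but set the last vertex
of each level aside and place these vertices after all blocks, deepest level first. The tree edges
between two consecutive blocks are then nested, and they go to the page given by the parity of the
upper level. The edges at the vertices set aside form one further nest around everything in each
page: page 0 takes those from the leftmost vertices, page 1 those from the next-to-last ones
(`noncrossing_xTreePage`). All other edges join neighbours on the spine. Noncrossing layouts are
realized by parabolic arcs (`hasBookEmbedding_of_noncrossing`). Edges along the spine and one edge
between its extreme positions can be added freely; unfolding the two pages gives a planar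
Hamiltonian graph. -/

/-! ### Drawings under injections and subgraphs -/

/-- Transport of a drawing along a continuous injection of the ambient space. -/
def GraphEmbedding.map {V X Y : Type*} [TopologicalSpace X] [TopologicalSpace Y]
    {G : SimpleGraph V} (φ : GraphEmbedding G X) (f : X → Y) (hf : Continuous f)
    (hi : Function.Injective f) : GraphEmbedding G Y where
  pt := f ∘ φ.pt
  arc e := f ∘ φ.arc e
  pt_injective := hi.comp φ.pt_injective
  arc_continuous e := hf.comp (φ.arc_continuous e)
  arc_injective e := hi.comp (φ.arc_injective e)
  arc_ends e := by
    have := congrArg (Sym2.map f) (φ.arc_ends e)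
    simpa [Sym2.map_map] using this
  arc_interior e t := by
    rintro ⟨v, hv⟩
    exact φ.arc_interior e t ⟨v, hi hv⟩
  arc_disjoint e f' hne s t h := by
    obtain ⟨v, hv⟩ := φ.arc_disjoint e f' hne s t (hi h)
    exact ⟨v, congrArg f hv⟩

/-- Restriction of a drawing to a copy of a smaller graph. -/
def GraphEmbedding.comp {V W X : Type*} [TopologicalSpace X]
    {G : SimpleGraph V} {H : SimpleGraph W} (φ : GraphEmbedding H X) (c : G.Copy H) :
    GraphEmbedding G X where
  pt := φ.pt ∘ c
  arc e := φ.arc (c.mapEdgeSet e)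
  pt_injective := φ.pt_injective.comp c.injective
  arc_continuous e := φ.arc_continuous _
  arc_injective e := φ.arc_injective _
  arc_ends e := by
    rw [φ.arc_ends, ← Sym2.map_map]
    rfl
  arc_interior e t := by
    rintro ⟨v, hv⟩
    exact φ.arc_interior _ t ⟨c v, hv⟩
  arc_disjoint e f hne s t h := by
    -- The common point represents a vertex of `H`, perhaps not one of `G`; being on the arc, it is
    -- an end of the arc, hence comes from `G`.
    have h0 := φ.arc_interior _ s
      (φ.arc_disjoint _ _ (fun h => hne (c.mapEdgeSet.injective h)) s t h)
    have hends : s(φ.arc (c.mapEdgeSet e) 0, φ.arc (c.mapEdgeSet e) 1) =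
        (e : Sym2 V).map (φ.pt ∘ c) := by
      rw [φ.arc_ends, ← Sym2.map_map]
      rfl
    have hmem : φ.arc (c.mapEdgeSet e) s ∈ (e : Sym2 V).map (φ.pt ∘ c) := by
      rw [← hends]
      rcases h0 with rfl | rfl
      · exact Sym2.mem_mk_left _ _
      · exact Sym2.mem_mk_right _ _
    obtain ⟨v, -, hv⟩ := Sym2.mem_map.1 hmem
    exact ⟨v, hv⟩

lemma HasBookEmbedding.of_isContained {V W : Type*} {G : SimpleGraph V} {H : SimpleGraph W}
    {k : ℕ} (hH : HasBookEmbedding H k) (hGH : G.IsContained H) : HasBookEmbedding G k := by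
  obtain ⟨φ, hpt, harc⟩ := hH
  obtain ⟨c⟩ := hGH
  exact ⟨φ.comp c, fun v => hpt _, fun e => harc _⟩

/-- The book with two pages unfolds to the plane. -/
lemma HasBookEmbedding.isPlanarGraph {V : Type*} {G : SimpleGraph V}
    (hG : HasBookEmbedding G 2) : IsPlanarGraph G := by
  obtain ⟨φ, -⟩ := hG
  have hval : Continuous fun p : Book 2 => p.1 := continuous_subtype_val
  refine ⟨φ.map (fun p => !₂[p.1.1, p.1.2 0 - p.1.2 1]) ?_ ?_⟩
  · have h1 : Continuous fun p : Book 2 => p.1.1 := continuous_fst.comp hval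
    have h2 (i : Fin 2) : Continuous fun p : Book 2 => p.1.2 i :=
      (continuous_apply i).comp (continuous_snd.comp hval)
    refine (PiLp.continuous_toLp 2 _).comp (continuous_pi fun i => ?_)
    fin_cases i
    · exact h1
    · exact (h2 0).sub (h2 1)
  · rintro ⟨⟨x, y⟩, hy, hy'⟩ ⟨⟨x', z⟩, hz, hz'⟩ h
    have h0 := congrFun (congrArg WithLp.ofLp h) 0
    have h1 := congrFun (congrArg WithLp.ofLp h) 1
    simp only [Matrix.cons_val_zero, Matrix.cons_val_one] at h0 h1
    have a0 := hy 0
    have a1 := hy 1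
    have b0 := hz 0
    have b1 := hz 1
    -- At most one of the two nonnegative heights is nonzero, so their difference determines both.
    have key : y 0 = z 0 ∧ y 1 = z 1 := by
      rcases hy' 0 1 (by decide) with a | a <;> rcases hz' 0 1 (by decide) with b | b <;>
        simp only at a b h1 a0 a1 b0 b1 <;> constructor <;> linarith
    refine Subtype.ext (Prod.ext h0 (funext fun i => ?_))
    fin_cases i
    · exact key.1
    · exact key.2

/-! ### Noncrossing page assignments give book embeddings -/

/-- The point at abscissa `x` of the parabolic arc over `[a, b]` in page `i`. -/
def Book.parabola {k : ℕ} (i : Fin k) (a b x : ℝ) (hx : 0 ≤ (x - a) * (b - x)) : Book k :=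
  ⟨(x, Pi.single i ((x - a) * (b - x))), fun j => by
    by_cases h : j = i
    · subst h; simpa using hx
    · simp [h], fun j j' hne => by
    by_cases h : j = i
    · right; subst h; simp [hne.symm]
    · simp [h]⟩

/-- A point of the spine. -/
def Book.spinePoint (k : ℕ) (x : ℝ) : Book k :=
  ⟨(x, 0), fun _ => le_rfl, fun _ _ _ => Or.inl rfl⟩

/-- Two parabolic arcs over intervals that do not cross meet only on the spine. -/
lemma eq_of_parabola_eq {a b c d x : ℝ} (hab : a < x) (hb : x < b) (hc : c < x) (hd : x < d)
    (h1 : ¬(a < c ∧ c < b ∧ b < d)) (h2 : ¬(c < a ∧ a < d ∧ d < b))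
    (h : (x - a) * (b - x) = (x - c) * (d - x)) : a = c ∧ b = d := by
  -- For nested intervals both factors of the outer parabola dominate those of the inner one.
  have key : ∀ {a b c d : ℝ}, a < x → x < b → c < x → x < d → a ≤ c → d ≤ b →
      (x - a) * (b - x) = (x - c) * (d - x) → a = c ∧ b = d := by
    intro a b c d ha hb hc hd hac hdb h
    by_contra hne
    have : a < c ∨ d < b := by
      by_contra! hcon
      exact hne ⟨by linarith [hcon.1], by linarith [hcon.2]⟩
    rcases this with h' | h'
    · nlinarith [mul_pos (sub_pos.2 h') (sub_pos.2 hb), mul_nonneg (sub_nonneg.2 hdb) (sub_pos.2 hc).le]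
    · nlinarith [mul_pos (sub_pos.2 h') (sub_pos.2 ha), mul_pos (sub_pos.2 h') (sub_pos.2 hc),
        mul_nonneg (sub_nonneg.2 hac) (sub_pos.2 hb).le]
  rcases lt_trichotomy a c with hlt | rfl | hlt
  · exact key hab hb hc hd hlt.le (not_lt.1 fun hbd => h1 ⟨hlt, hc.trans hb, hbd⟩) h
  · rcases le_total d b with hle | hle
    · exact key hab hb hc hd le_rfl hle h
    · obtain ⟨h3, h4⟩ := key hc hd hab hb le_rfl hle h.symm
      exact ⟨h3.symm, h4.symm⟩
  · obtain ⟨h3, h4⟩ := key hc hd hab hb hlt.le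
      (not_lt.1 fun hbd => h2 ⟨hlt, hab.trans hd, hbd⟩) h.symm
    exact ⟨h3.symm, h4.symm⟩

/-- If the edges of a graph on linearly ordered vertices are distributed to `k` pages so that no
two edges in a page cross, then the graph has a `k`-page book embedding. -/
theorem hasBookEmbedding_of_noncrossing {n k : ℕ} (G : SimpleGraph (Fin n))
    (page : G.edgeSet → Fin k)
    (hpage : ∀ e f, page e = page f →
      ¬ ((e : Sym2 (Fin n)).inf < (f : Sym2 (Fin n)).inf ∧
        (f : Sym2 (Fin n)).inf < (e : Sym2 (Fin n)).sup ∧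
        (e : Sym2 (Fin n)).sup < (f : Sym2 (Fin n)).sup)) :
    HasBookEmbedding G k := by
  let lo (e : G.edgeSet) : ℝ := ((e : Sym2 (Fin n)).inf : ℕ)
  let hi (e : G.edgeSet) : ℝ := ((e : Sym2 (Fin n)).sup : ℕ)
  have hlt (e : G.edgeSet) : lo e < hi e := by
    obtain ⟨e, he⟩ := e
    induction e with | h a b
    have hne : a ≠ b := G.ne_of_adj he
    simp only [lo, hi, Sym2.inf_mk, Sym2.sup_mk]
    exact_mod_cast inf_lt_sup.2 hne
  let ab (e : G.edgeSet) (t : unitInterval) : ℝ := lo e + (hi e - lo e) * t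
  have hab (e : G.edgeSet) (t : unitInterval) : (ab e t - lo e) * (hi e - ab e t) =
      (hi e - lo e) ^ 2 * (t * (1 - t)) := by
    simp only [ab]; ring
  have hab0 (e : G.edgeSet) (t : unitInterval) : 0 ≤ (ab e t - lo e) * (hi e - ab e t) := by
    rw [hab]
    exact mul_nonneg (sq_nonneg _) (mul_nonneg t.2.1 (sub_nonneg.2 t.2.2))
  have hzero (e : G.edgeSet) (t : unitInterval)
      (h : (ab e t - lo e) * (hi e - ab e t) = 0) : t = 0 ∨ t = 1 := by
    rw [hab] at h
    rcases mul_eq_zero.1 h with h | h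
    · exact absurd (pow_eq_zero_iff (two_ne_zero)|>.1 h) (sub_pos.2 (hlt e)).ne'
    · rcases mul_eq_zero.1 h with h | h
      · exact Or.inl (Subtype.ext h)
      · exact Or.inr (Subtype.ext (by simpa using (sub_eq_zero.1 h).symm))
  let arc (e : G.edgeSet) (t : unitInterval) : Book k :=
    Book.parabola (page e) (lo e) (hi e) (ab e t) (hab0 e t)
  let pt (v : Fin n) : Book k := Book.spinePoint k (v : ℕ)
  have harc0 (e : G.edgeSet) : arc e 0 = pt (e : Sym2 (Fin n)).inf := by
    refine Subtype.ext (Prod.ext ?_ ?_)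
    · simp [arc, pt, Book.parabola, Book.spinePoint, ab, lo]
    · simp [arc, pt, Book.parabola, Book.spinePoint, ab, lo]
  have harc1 (e : G.edgeSet) : arc e 1 = pt (e : Sym2 (Fin n)).sup := by
    refine Subtype.ext (Prod.ext ?_ ?_)
    · simp [arc, pt, Book.parabola, Book.spinePoint, ab, hi]
    · simp [arc, pt, Book.parabola, Book.spinePoint, ab, hi]
  have hspine (e : G.edgeSet) (t : unitInterval) (h : arc e t ∈ Book.spine k) :
      t = 0 ∨ t = 1 := by
    refine hzero e t ?_
    simpa [arc, Book.parabola] using h (page e)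
  have hptspine (v : Fin n) : pt v ∈ Book.spine k := fun i => rfl
  have hend (e : G.edgeSet) (t : unitInterval) (h : t = 0 ∨ t = 1) :
      arc e t ∈ Set.range pt := by
    rcases h with rfl | rfl
    · exact ⟨_, (harc0 e).symm⟩
    · exact ⟨_, (harc1 e).symm⟩
  have hendspine (e : G.edgeSet) (t : unitInterval) (h : t = 0 ∨ t = 1) :
      arc e t ∈ Book.spine k := by
    obtain ⟨v, hv⟩ := hend e t h
    exact hv ▸ hptspine v
  have hinj (e : G.edgeSet) : Function.Injective (ab e) := by
    intro s t h
    have := mul_left_cancel₀ (sub_pos.2 (hlt e)).ne' (add_left_cancel h)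
    exact Subtype.ext this
  refine ⟨{ pt := pt, arc := arc, pt_injective := ?_, arc_continuous := ?_, arc_injective := ?_,
            arc_ends := ?_, arc_interior := ?_, arc_disjoint := ?_ }, hptspine, fun e =>
            ⟨⟨page e, ?_⟩, fun t => ⟨hspine e t, hendspine e t⟩⟩⟩
  · intro u v h
    have : ((u : ℕ) : ℝ) = (v : ℕ) := congrArg (fun p : Book k => p.1.1) h
    exact Fin.ext (by exact_mod_cast this)
  · intro e
    have hc : Continuous (ab e) := by fun_prop
    refine Continuous.subtype_mk (hc.prodMk ?_) _
    exact (continuous_single (page e)).comp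
      ((hc.sub continuous_const).mul (continuous_const.sub hc))
  · intro e s t h
    exact hinj e (congrArg (fun p : Book k => p.1.1) h)
  · intro e
    rw [harc0, harc1, ← Sym2.map_mk]
    congr 1
    exact Sym2.sortEquiv.symm_apply_apply (e : Sym2 (Fin n))
  · rintro e t ⟨v, hv⟩
    exact hspine e t (hv ▸ hptspine v)
  · intro e f hne s t h
    by_cases hs : s = 0 ∨ s = 1
    · exact hend e s hs
    exfalso
    have hx : ab e s = ab f t := congrArg (fun p : Book k => p.1.1) h
    have hy : (Pi.single (page e) ((ab e s - lo e) * (hi e - ab e s)) : Fin k → ℝ) =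
      Pi.single (page f) ((ab f t - lo f) * (hi f - ab f t)) :=
      congrArg (fun p : Book k => p.1.2) h
    have hpos : 0 < (ab e s - lo e) * (hi e - ab e s) :=
      (hab0 e s).lt_of_ne fun h0 => hs (hzero e s h0.symm)
    have hpe : page e = page f := by
      by_contra hpne
      have := congrFun hy (page e)
      simp only [Pi.single_eq_same, Pi.single_eq_of_ne hpne] at this
      exact hpos.ne' this
    have hval : (ab e s - lo e) * (hi e - ab e s) = (ab f t - lo f) * (hi f - ab f t) := by
      have := congrFun hy (page e)
      rw [hpe] at this
      simpa using this
    have hbound (e : G.edgeSet) (s : unitInterval)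
        (hpos : 0 < (ab e s - lo e) * (hi e - ab e s)) : lo e < ab e s ∧ ab e s < hi e := by
      have h1 : lo e ≤ ab e s :=
        le_add_of_nonneg_right (mul_nonneg (sub_pos.2 (hlt e)).le s.2.1)
      have h2 : 0 < ab e s - lo e := (sub_nonneg.2 h1).lt_of_ne fun h0 => by
        rw [← h0, zero_mul] at hpos
        exact hpos.false
      exact ⟨sub_pos.1 h2, sub_pos.1 (pos_of_mul_pos_right hpos h2.le)⟩
    have h1 := hbound e s hpos
    have h2 := hbound f t (hval ▸ hpos)
    rw [← hx] at h2 hval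
    obtain ⟨h3, h4⟩ := eq_of_parabola_eq h1.1 h1.2 h2.1 h2.2
      (by simpa only [lo, hi, Nat.cast_lt, Fin.val_fin_lt] using hpage e f hpe)
      (by simpa only [lo, hi, Nat.cast_lt, Fin.val_fin_lt] using hpage f e hpe.symm) hval
    refine hne (Subtype.ext (Sym2.inf_eq_inf_and_sup_eq_sup.1 ⟨Fin.ext ?_, Fin.ext ?_⟩))
    · exact Nat.cast_injective (R := ℝ) h3
    · exact Nat.cast_injective (R := ℝ) h4
  · intro t j hj
    simp [arc, Book.parabola, hj]

/-! ### Two-page layouts and the cycle along the spine -/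

/-- No two intervals of `E` cross. -/
def Noncrossing (E : ℕ → ℕ → Prop) : Prop :=
  ∀ a b c d, E a b → E c d → ¬ (a < c ∧ c < b ∧ b < d)

/-- A linear order of the vertices and a distribution of the edges to two pages without crossings
give a book embedding, and adding the cycle along the spine shows subhamiltonicity. Edges between
consecutive positions need not be assigned to a page. -/
theorem isSubhamiltonian_and_hasBookEmbedding_of_layout {V : Type*} (G : SimpleGraph V) (n : ℕ)
    (hn : 3 ≤ n) (p : V → ℕ) (hp : Function.Injective p) (hpn : ∀ v, p v < n)
    (E : Fin 2 → ℕ → ℕ → Prop) (hE : ∀ i, Noncrossing (E i)) (hlt : ∀ i a b, E i a b → a < b)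
    (hadj : ∀ u v, G.Adj u v → (p v = p u + 1 ∨ ∃ i, E i (p u) (p v)) ∨
      (p u = p v + 1 ∨ ∃ i, E i (p v) (p u))) :
    IsSubhamiltonian G ∧ HasBookEmbedding G 2 := by
  classical
  -- The added intervals cross nothing in either page: no position lies inside `(a, a + 1)` or
  -- outside `[0, n - 1]`.
  let R (i : Fin 2) (a b : ℕ) : Prop := a < b ∧ (b = a + 1 ∨ (a = 0 ∧ b + 1 = n) ∨ E i a b)
  let H : SimpleGraph (Fin n) := SimpleGraph.fromRel fun u v => ∃ i, R i u v
  have hR (u v : Fin n) (i : Fin 2) (h : R i u v) : H.Adj u v :=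
    (SimpleGraph.fromRel_adj _ _ _).2 ⟨fun huv => h.1.ne (congrArg Fin.val huv), Or.inl ⟨i, h⟩⟩
  have hbook : HasBookEmbedding H 2 := by
    have hpage (e : H.edgeSet) :
        ∃ i, R i (e : Sym2 (Fin n)).inf.val (e : Sym2 (Fin n)).sup.val := by
      obtain ⟨e, he⟩ := e
      induction e with | h u v
      obtain ⟨-, ⟨i, h⟩ | ⟨i, h⟩⟩ := (SimpleGraph.fromRel_adj _ _ _).1 ((SimpleGraph.mem_edgeSet _).1 he)
      · refine ⟨i, ?_⟩
        have huv : u ≤ v := h.1.le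
        simpa only [Sym2.inf_mk, Sym2.sup_mk, inf_eq_left.2 huv, sup_eq_right.2 huv] using h
      · refine ⟨i, ?_⟩
        have huv : v ≤ u := h.1.le
        simpa only [Sym2.inf_mk, Sym2.sup_mk, inf_eq_right.2 huv, sup_eq_left.2 huv] using h
    choose page hpage using hpage
    refine hasBookEmbedding_of_noncrossing H page fun e f hef => ?_
    have he := hpage e
    have hf := hpage f
    rw [← hef] at hf
    rintro ⟨h1, h2, h3⟩
    rw [Fin.lt_def] at h1 h2 h3
    have := (f : Sym2 (Fin n)).sup.isLt
    rcases he.2 with h | h | h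
    · lia
    · lia
    · rcases hf.2 with h' | h' | h'
      · lia
      · lia
      · exact hE _ _ _ _ _ h h' ⟨h1, h2, h3⟩
  have hcont : G.IsContained H := by
    refine ⟨⟨⟨fun v => ⟨p v, hpn v⟩, fun {u v} huv => ?_⟩, fun u v h => hp (Fin.mk.inj h)⟩⟩
    rcases hadj u v huv with (h | ⟨i, h⟩) | (h | ⟨i, h⟩)
    · exact hR _ _ 0 ⟨by simp [h], Or.inl h⟩
    · exact hR _ _ i ⟨hlt _ _ _ h, Or.inr (Or.inr h)⟩
    · exact (hR _ _ 0 ⟨by simp [h], Or.inl h⟩).symm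
    · exact (hR _ _ i ⟨hlt _ _ _ h, Or.inr (Or.inr h)⟩).symm
  have hham : H.IsHamiltonian := by
    have hle : SimpleGraph.cycleGraph n ≤ H := by
      have key (u v : Fin n) (h : (v - u).val = 1) : H.Adj u v := by
        rcases le_or_gt u v with huv | huv
        · rw [Fin.sub_val_of_le huv] at h
          exact hR _ _ 0 ⟨by lia, Or.inl (by lia)⟩
        · rw [Fin.coe_sub_iff_lt.2 huv] at h
          have := u.isLt
          exact (hR _ _ 0 ⟨huv, Or.inr (Or.inl ⟨by lia, by lia⟩)⟩).symm
      intro u v huv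
      rcases SimpleGraph.cycleGraph_adj'.1 huv with h | h
      · exact (key v u h).symm
      · exact key u v h
    refine SimpleGraph.IsHamiltonian.mono hle fun _ => ?_
    obtain ⟨m, rfl⟩ := Nat.exists_eq_add_of_le' hn
    exact ⟨0, SimpleGraph.cycleGraph.cycle m,
      SimpleGraph.Walk.isHamiltonianCycle_iff_isCycle_and_length_eq.2
        ⟨SimpleGraph.cycleGraph.isCycle_cycle, by simp⟩⟩
  exact ⟨⟨n, H, hbook.isPlanarGraph, hham, hcont⟩, hbook.of_isContained hcont⟩

/-! ### The layout of the X-tree -/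

/-- The position of a vertex of the X-tree on the spine: the last vertices of the levels come at the
end, in decreasing order of levels; before them come the other vertices, level by level, the even
levels from left to right and the odd levels from right to left. -/
def xTreePosition (h : ℕ) (v : XTreeVertex h) : ℕ :=
  if (v.2 : ℕ) + 1 = 2 ^ (v.1 : ℕ) then 2 ^ (h + 2) - v.1
  else if (v.1 : ℕ) % 2 = 0 then 2 ^ (v.1 : ℕ) + v.2 else 2 ^ ((v.1 : ℕ) + 1) - 1 - v.2

/-- The intervals in page `c`: the tree edges descending from a level of the parity of `c`, and
edges from an end of a level to the last vertex of that level or of the level above. -/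
def xTreePage (h c x y : ℕ) : Prop :=
  -- For even `l`, vertex `k` is at `2 ^ l + k` and its children are at `4 * 2 ^ l - 1 - 2 * k` and
  -- one before; odd `l` gives the same two equations, swapped.
  (∃ l, l < h ∧ l % 2 = c ∧ 2 ^ l + c ≤ x ∧ x < 2 * 2 ^ l ∧
    (y + 2 * x + 1 = 6 * 2 ^ l ∨ y + 2 * x + 2 = 6 * 2 ^ l)) ∨
  -- For both parities of `l`, `x` is the leftmost vertex of level `l` if `c = 0`, and the
  -- next-to-last one if `c = 1`.
  ∃ l m, 1 ≤ l ∧ l ≤ h ∧ m ≤ l ∧ l ≤ m + 1 ∧ y + m = 2 ^ (h + 2) ∧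
    (l % 2 = c ∧ x = 2 ^ l + c ∨ l % 2 ≠ c ∧ x + 1 + c = 2 * 2 ^ l)

lemma two_mul_two_pow_le {l m : ℕ} (h : l < m) : 2 * 2 ^ l ≤ 2 ^ m := by
  rw [← pow_succ']
  exact Nat.pow_le_pow_right two_pos h

lemma four_mul_two_pow_le {l m : ℕ} (h : l + 1 < m) : 4 * 2 ^ l ≤ 2 ^ m := by
  have h1 := two_mul_two_pow_le h
  rw [pow_succ] at h1
  lia

lemma xTreePage_lt {h c x y : ℕ} (hc : c ≤ 1) (H : xTreePage h c x y) : x < y := by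
  rcases H with ⟨l, -, -, h1, h2, h3⟩ | ⟨l, m, hl, hlh, hml, -, hy, hx⟩
  · lia
  · have h1 : 2 * 2 ^ l ≤ 2 * 2 ^ h := by
      have := Nat.pow_le_pow_right two_pos hlh
      lia
    have h2 : h < 2 ^ h := Nat.lt_two_pow_self
    have h3 : 2 ^ 1 ≤ 2 ^ l := Nat.pow_le_pow_right two_pos hl
    have h4 : 2 ^ (h + 2) = 4 * 2 ^ h := by ring
    lia

/-- Tree intervals from one level are nested, as `y` decreases when `x` grows; those from different
levels of the same parity are disjoint. For intervals of the second kind, `x` grows and `y` weakly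
decreases with `l`, and no tree interval passes over their left ends. -/
lemma noncrossing_xTreePage (h c : ℕ) (hc : c ≤ 1) : Noncrossing (xTreePage h c) := by
  have hh : 2 ^ (h + 2) = 4 * 2 ^ h := by ring
  have hh' : h < 2 ^ h := Nat.lt_two_pow_self
  rintro x y x' y' H H' ⟨h1, h2, h3⟩
  rcases H with ⟨l, hl, hlc, ha, hb, hy⟩ | ⟨l, m, hl, hlh, hml, hlm, hy, hx⟩ <;>
    rcases H' with ⟨l', hl', hlc', ha', hb', hy'⟩ | ⟨l', m', hl', hlh', hml', hlm', hy', hx'⟩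
  · rcases lt_trichotomy l l' with hll | rfl | hll
    · have := four_mul_two_pow_le (show l + 1 < l' by lia)
      lia
    · lia
    · have := two_mul_two_pow_le hll
      lia
  · have e : 2 ^ 1 ≤ 2 ^ l' := Nat.pow_le_pow_right two_pos hl'
    rcases lt_trichotomy l l' with hll | rfl | hll
    · rcases (show l' = l + 1 ∨ l + 1 < l' by lia) with rfl | hll'
      · rw [pow_succ] at hx' e
        lia
      · have := four_mul_two_pow_le hll'
        lia
    · lia
    · have := two_mul_two_pow_le hll
      lia
  · have := two_mul_two_pow_le hl'
    lia
  · have e : 2 ^ 1 ≤ 2 ^ l := Nat.pow_le_pow_right two_pos hl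
    rcases lt_trichotomy l l' with hll | rfl | hll
    · lia
    · lia
    · have := two_mul_two_pow_le hll
      have e : 2 ^ 1 ≤ 2 ^ l' := Nat.pow_le_pow_right two_pos hl'
      lia

/-- The blocks lie in the disjoint intervals `[2 ^ l, 2 ^ (l + 1))`, and the last vertices lie
beyond `2 ^ (h + 1)` because `h < 2 ^ h`. -/
lemma xTreePosition_injective (h : ℕ) : Function.Injective (xTreePosition h) := by
  rintro ⟨⟨l, hl⟩, ⟨k, hk⟩⟩ ⟨⟨l', hl'⟩, ⟨k', hk'⟩⟩ H
  simp only [xTreePosition] at H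
  simp only at hk hk'
  have hh : 2 ^ (h + 2) = 4 * 2 ^ h := by ring
  have hh' : h < 2 ^ h := Nat.lt_two_pow_self
  have e1 : 2 ^ l ≤ 2 ^ h := Nat.pow_le_pow_right two_pos (by lia)
  have e2 : 2 ^ l' ≤ 2 ^ h := Nat.pow_le_pow_right two_pos (by lia)
  rw [pow_succ 2 l, pow_succ 2 l'] at H
  have hll : l = l' := by
    rcases lt_trichotomy l l' with hll | hll | hll
    · have := two_mul_two_pow_le hll
      split_ifs at H <;> lia
    · exact hll
    · have := two_mul_two_pow_le hll
      split_ifs at H <;> lia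
  subst hll
  have hkk : k = k' := by split_ifs at H <;> lia
  subst hkk
  rfl

theorem extendedXTree_subhamiltonian_and_book (h : ℕ) :
    IsSubhamiltonian (extendedXTree h) ∧ HasBookEmbedding (extendedXTree h) 2 := by
  have hh : 2 ^ (h + 2) = 4 * 2 ^ h := by ring
  have hh' : h < 2 ^ h := Nat.lt_two_pow_self
  have h1 : 1 ≤ 2 ^ h := Nat.one_le_two_pow
  -- The root has the largest position, `2 ^ (h + 2)`. Unoccupied positions become extra vertices of
  -- the Hamiltonian graph.
  refine isSubhamiltonian_and_hasBookEmbedding_of_layout _ (2 ^ (h + 2) + 1) (by lia)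
    (xTreePosition h) (xTreePosition_injective h) ?_ (fun i => xTreePage h i)
    (fun i => noncrossing_xTreePage h i (by lia)) (fun i a b => xTreePage_lt (by lia)) ?_
  · rintro ⟨⟨l, hl⟩, ⟨k, hk⟩⟩
    simp only [xTreePosition]
    simp only at hk
    have e1 : 2 ^ l ≤ 2 ^ h := Nat.pow_le_pow_right two_pos (by lia)
    rw [pow_succ 2 l]
    split_ifs <;> lia
  · let S (u v : XTreeVertex h) : Prop :=
      xTreePosition h v = xTreePosition h u + 1 ∨
        ∃ i : Fin 2, xTreePage h i (xTreePosition h u) (xTreePosition h v)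
    change ∀ u v, _ → S u v ∨ S v u
    have htree (u v : XTreeVertex h) (H : (v.1 : ℕ) = u.1 + 1 ∧
        ((v.2 : ℕ) = 2 * u.2 ∨ (v.2 : ℕ) = 2 * u.2 + 1)) : S u v ∨ S v u := by
      obtain ⟨⟨l, hl⟩, ⟨k, hk⟩⟩ := u
      obtain ⟨⟨l', hl'⟩, ⟨k', hk'⟩⟩ := v
      simp only at H hk hk'
      obtain ⟨rfl, H⟩ := H
      have e1 : 2 ^ (l + 1) = 2 * 2 ^ l := by ring
      have e3 : 2 ^ (l + 1 + 1) = 4 * 2 ^ l := by ring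
      have e2 : 2 ^ (l + 1) ≤ 2 ^ h := Nat.pow_le_pow_right two_pos (by lia)
      -- The left child of a last vertex is next-to-last on its level, hence page 1; the right child
      -- is again last, hence a neighbour on the spine.
      by_cases hlast : k + 1 = 2 ^ l
      · rcases H with rfl | rfl
        · right; right
          refine ⟨1, Or.inr ⟨l + 1, l, by lia, by lia, by lia, le_rfl, ?_, ?_⟩⟩
          · simp only [xTreePosition, if_pos hlast]
            lia
          · simp only [xTreePosition, Fin.val_one, e1, e3]
            split_ifs <;> lia
        · right; left
          simp only [xTreePosition, if_pos hlast, e1]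
          rw [if_pos (by lia)]
          lia
      · left; right
        refine ⟨⟨l % 2, by lia⟩, Or.inl ⟨l, by lia, rfl, ?_⟩⟩
        simp only [xTreePosition, if_neg hlast, e1, e3]
        split_ifs <;> lia
    have hend (u v : XTreeVertex h) (hl : (v.1 : ℕ) = u.1) (hne : (u.2 : ℕ) + 1 ≠ 2 ^ (u.1 : ℕ))
        (hv : (v.2 : ℕ) + 1 = 2 ^ (v.1 : ℕ)) (hu : (u.2 : ℕ) = 0 ∨ (u.2 : ℕ) + 1 = v.2) : S u v := by
      obtain ⟨⟨l, hlh⟩, ⟨k, hk⟩⟩ := u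
      obtain ⟨⟨l', hl'⟩, ⟨k', hk'⟩⟩ := v
      simp only at hl hne hv hu hk hk'
      subst hl
      have e1 : 2 ^ (l' + 1) = 2 * 2 ^ l' := by ring
      have e2 : 2 ^ l' ≤ 2 ^ h := Nat.pow_le_pow_right two_pos (by lia)
      have hl1 : 1 ≤ l' := by
        rcases Nat.eq_zero_or_pos l' with rfl | hpos
        · simp only [pow_zero] at *
          lia
        · exact hpos
      rcases hu with hu | hu
      · right
        refine ⟨0, Or.inr ⟨l', l', hl1, by lia, le_rfl, by lia, ?_, ?_⟩⟩
        · simp only [xTreePosition, if_pos hv]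
          lia
        · simp only [xTreePosition, if_neg hne, Fin.val_zero, e1]
          split_ifs <;> lia
      · right
        refine ⟨1, Or.inr ⟨l', l', hl1, by lia, le_rfl, by lia, ?_, ?_⟩⟩
        · simp only [xTreePosition, if_pos hv]
          lia
        · simp only [xTreePosition, if_neg hne, Fin.val_one, e1]
          split_ifs <;> lia
    have hpath (u v : XTreeVertex h) (H : (v.1 : ℕ) = u.1 ∧ (v.2 : ℕ) = u.2 + 1) :
        S u v ∨ S v u := by
      have hv2 := v.2.isLt
      have hne : (u.2 : ℕ) + 1 ≠ 2 ^ (u.1 : ℕ) := by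
        have hpow : 2 ^ (v.1 : ℕ) = 2 ^ (u.1 : ℕ) := congrArg _ H.1
        lia
      by_cases hlast : (v.2 : ℕ) + 1 = 2 ^ (v.1 : ℕ)
      · exact Or.inl (hend u v H.1 hne hlast (Or.inr H.2.symm))
      · rcases Nat.mod_two_eq_zero_or_one (v.1 : ℕ) with hm | hm
        · left; left
          simp only [xTreePosition, if_neg hlast, ← H.1, hm, if_true]
          lia
        · right; left
          have e1 : 2 ^ ((v.1 : ℕ) + 1) = 2 * 2 ^ (v.1 : ℕ) := by ring
          simp only [xTreePosition, if_neg hlast, ← H.1, hm, one_ne_zero, if_false, e1]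
          lia
    have hclose (u v : XTreeVertex h) (huv : u ≠ v) (H : (v.1 : ℕ) = u.1 ∧ (u.2 : ℕ) = 0 ∧
        (v.2 : ℕ) + 1 = 2 ^ (v.1 : ℕ)) : S u v ∨ S v u := by
      refine Or.inl (hend u v H.1 (fun hu => huv ?_) H.2.2 (Or.inl H.2.1))
      obtain ⟨⟨l, hlh⟩, ⟨k, hk⟩⟩ := u
      obtain ⟨⟨l', hl'⟩, ⟨k', hk'⟩⟩ := v
      simp only at H hu
      obtain ⟨rfl, H⟩ := H
      obtain rfl : k = k' := by lia
      rfl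
    intro u v huv
    rcases huv with (huv | huv) | huv
    · rcases ((SimpleGraph.fromRel_adj _ _ _).1 huv).2 with H | H
      · exact htree u v H
      · exact (htree v u H).symm
    · rcases ((SimpleGraph.fromRel_adj _ _ _).1 huv).2 with H | H
      · exact hpath u v H
      · exact (hpath v u H).symm
    · obtain ⟨hne, H | H⟩ := (SimpleGraph.fromRel_adj _ _ _).1 huv
      · exact hclose u v hne H
      · exact (hclose v u hne.symm H).symm

lemma IsSubhamiltonian.mono {V : Type*} {G G' : SimpleGraph V} (hle : G ≤ G')
    (hG : IsSubhamiltonian G') : IsSubhamiltonian G := by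
  obtain ⟨n, H, hp, hh, hc⟩ := hG
  exact ⟨n, H, hp, hh, hc.mono_left hle⟩

theorem corollary1 :
    (∀ h : ℕ, IsSubhamiltonian (extendedXTree h) ∧ HasBookEmbedding (extendedXTree h) 2) ∧
    (∀ h : ℕ, IsSubhamiltonian (xTree h) ∧ HasBookEmbedding (xTree h) 2) := by
  refine ⟨extendedXTree_subhamiltonian_and_book, fun h => ?_⟩
  obtain ⟨h1, h2⟩ := extendedXTree_subhamiltonian_and_book h
  have hle : xTree h ≤ extendedXTree h := le_sup_left
  exact ⟨h1.mono hle, h2.of_isContained (.of_le hle)⟩
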